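/- **Conventions.** A *2-plectic manifold* $(X,\omega)$ is a (finite-dimensional, Hausdorff, second countable, boundaryless) smooth manifold $X$ with a smooth 3-form $\omega$ that is closed, $d\omega=0$, and nondegenerate: for $v\in T_xX$, $\iota_v\omega=\omega(v,\cdot,\cdot)=0$ implies $v=0$. A smooth 1-form $F$ on $X$ is *Hamiltonian* if there is a smooth vector field $v_F$ with $dF=-\iota_{v_F}\omega$; then $v_F$ is unique. $\mathrm{Ham}(X)$ is the real vector space of Hamiltonian 1-forms. A *Lie 2-algebra* is a 2-term complex of vector spaces $L=(L_0\xleftarrow{d}L_1)$ with * a chain map $[\cdot,\cdot]\colon L\otimes L\to L$ (the *bracket*), i.e. bilinear brackets $[x,y]\in L_0$, $[x,f]\in L_1$, $[f,x]\in L_1$ for $x,y\in L_0$, $f\in L_1$ (and $0$ on $L_1\otimes L_1$) with $d[x,f]=[x,df]$, $d[f,x]=[df,x]$, $[df,g]=[f,dg]$; * a chain homotopy $S\colon[\cdot,\cdot]\Rightarrow-[\cdot,\cdot]\circ\sigma$ (the *alternator*; $\sigma$ is the switch), i.e. a bilinear map $S\colon L_0\times L_0\to L_1$ with $[x,y]+dS_{x,y}=-[y,x]$,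 $[x,f]+S_{x,df}=-[f,x]$, $[f,x]+S_{df,x}=-[x,f]$; * an antisymmetric chain homotopy $J\colon[\cdot,[\cdot,\cdot]]\Rightarrow[[\cdot,\cdot],\cdot]+[\cdot,[\cdot,\cdot]]\circ(\sigma\otimes1)$ (the *Jacobiator*), i.e. an antisymmetric trilinear map $J\colon L_0^3\to L_1$ with $[x,[y,z]]+dJ_{x,y,z}=[[x,y],z]+[y,[x,z]]$, and likewise, when exactly one of the three arguments $a,b,c$ is a 1-chain, $[a,[b,c]]+J_{a,b,c}=[[a,b],c]+[b,[a,c]]$ with the 1-chain $f$ replaced by $df$ inside $J$; such that for all $w,x,y,z\in L_0$ 1. $[w,J_{x,y,z}]+J_{w,[x,y],z}+J_{w,y,[x,z]}+[J_{w,x,y},z]+[y,J_{w,x,z}]=J_{w,x,[y,z]}+J_{[w,x],y,z}+[x,J_{w,y,z}]+J_{x,[w,y],z}+J_{x,y,[w,z]}$, 2. $[S_{x,y},z]+J_{y,x,z}=-J_{x,y,z}$, 3. $[x,S_{y,z}]-J_{x,z,y}=J_{x,y,z}+S_{[x,y],z}+S_{y,[x,z]}$, 4. $S_{x,[y,z]}-S_{[y,z],x}=0$.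 It is *hemistrict* if $J=0$. **Theorem.** Let $(X,\omega)$ be a 2-plectic manifold. There is a hemistrict Lie 2-algebra $L(X,\omega)_{\mathrm h}$ over $\mathbb R$ such that * the space of 0-chains is $\mathrm{Ham}(X)$ and the space of 1-chains is $C^\infty(X)$; * the differential is the exterior derivative $d\colon C^\infty(X)\to\mathrm{Ham}(X)$; * the bracket is the hemi-bracket: $\{F,G\}_{\mathrm h}=L_{v_F}G$, $\{F,f\}_{\mathrm h}=L_{v_F}f$, $\{f,F\}_{\mathrm h}=0$ for $F,G\in\mathrm{Ham}(X)$, $f\in C^\infty(X)$; * the alternator is $S_{F,G}=-(\iota_{v_F}G+\iota_{v_G}F)$; * the Jacobiator is the identity chain homotopy: $J_{F,G,H}=0$. -/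

import Mathlib

open scoped Manifold ContDiff Bundle

noncomputable section

namespace TwoPlectic

section Forms

variable {E : Type*} [NormedAddCommGroup E] [NormedSpace ℝ E]
  {H : Type*} [TopologicalSpace H] (I : ModelWithCorners ℝ E H)
  {X : Type*} [TopologicalSpace X] [ChartedSpace H X]

/-- The expression of a (not necessarily smooth) `k`-form `η` on `X` in the chart around `x₀`:
the pullback of `η` along the inverse of that chart, a `k`-form on the model space `E`. It is
meaningful on the target of the chart. -/
def chartRep {k : ℕ} (η : ∀ x : X, TangentSpace I x [⋀^Fin k]→L[ℝ] ℝ) (x₀ : X) (y : E) :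
    E [⋀^Fin k]→L[ℝ] ℝ :=
  (η ((extChartAt I x₀).symm y)).compContinuousLinearMap
    (mfderivWithin 𝓘(ℝ, E) I (extChartAt I x₀).symm (Set.range I) y)

variable (X) in
/-- The real vector space `Ω^k(X)` of smooth differential `k`-forms on `X`: families of
alternating `k`-linear forms on the tangent spaces that are smooth in every chart. -/
def Ω (k : ℕ) : Submodule ℝ (∀ x : X, TangentSpace I x [⋀^Fin k]→L[ℝ] ℝ) where
  carrier := {η | ∀ x₀ : X, ContDiffOn ℝ ∞ (chartRep I η x₀) (extChartAt I x₀).target}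
  zero_mem' _ := contDiffOn_const (c := 0)
  add_mem' hη hθ x₀ := (hη x₀).add (hθ x₀)
  smul_mem' c _ hη x₀ := (hη x₀).const_smul c

/-- The exterior derivative of a form at the point `x`, computed in the chart around `x`. -/
def extDerivAt {k : ℕ} (η : ∀ x : X, TangentSpace I x [⋀^Fin k]→L[ℝ] ℝ) (x : X) :
    TangentSpace I x [⋀^Fin (k + 1)]→L[ℝ] ℝ :=
  (extDeriv (chartRep I η x) (extChartAt I x x)).compContinuousLinearMap
    (mfderiv I 𝓘(ℝ, E) (extChartAt I x) x)

/-- The interiorProduct product `ι_v α = α(v, ·, …, ·)` of a tangent vector with an alternating form. -/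
def interiorProduct {k : ℕ} {x : X} (v : TangentSpace I x) (α : TangentSpace I x [⋀^Fin (k + 1)]→L[ℝ] ℝ) :
    TangentSpace I x [⋀^Fin k]→L[ℝ] ℝ :=
  { α.toAlternatingMap.curryLeft v with
    cont := α.cont.comp (continuous_const.matrixVecCons continuous_id) }

theorem interiorProduct_apply {k : ℕ} {x : X} (v : TangentSpace I x)
    (α : TangentSpace I x [⋀^Fin (k + 1)]→L[ℝ] ℝ) (u : Fin k → TangentSpace I x) :
    interiorProduct I v α u = α (Matrix.vecCons v u) := rfl

theorem interiorProduct_add {k : ℕ} {x : X} (v w : TangentSpace I x)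
    (α : TangentSpace I x [⋀^Fin (k + 1)]→L[ℝ] ℝ) :
    interiorProduct I (v + w) α = interiorProduct I v α + interiorProduct I w α := by
  ext u
  exact α.toAlternatingMap.map_vecCons_add u v w

theorem interiorProduct_smul {k : ℕ} {x : X} (c : ℝ) (v : TangentSpace I x)
    (α : TangentSpace I x [⋀^Fin (k + 1)]→L[ℝ] ℝ) :
    interiorProduct I (c • v) α = c • interiorProduct I v α := by
  ext u
  exact α.toAlternatingMap.map_vecCons_smul u c v

/-- The pairing `ι_v α = α(v)` of a tangent vector with a `1`-form, as a real number. -/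
def pairing {x : X} (v : TangentSpace I x) (α : TangentSpace I x [⋀^Fin 1]→L[ℝ] ℝ) : ℝ :=
  α ![v]

/-- The exterior derivative of a function `f` at `x`, a `1`-form: `(df)_x(v) = v(f)`. -/
def dFun (f : X → ℝ) (x : X) : TangentSpace I x [⋀^Fin 1]→L[ℝ] ℝ :=
  ContinuousAlternatingMap.ofSubsingleton ℝ (TangentSpace I x) ℝ (0 : Fin 1)
    (mfderiv I 𝓘(ℝ, ℝ) f x)

/-- The Lie derivative of a function along a vector field: `L_v f = v(f) = df(v)`. -/
def lieDerivFun (v : ∀ x : X, TangentSpace I x) (f : X → ℝ) (x : X) : ℝ :=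
  mfderiv I 𝓘(ℝ, ℝ) f x (v x)

/-- The expression of a vector field on `X` in the chart around `x₀`: its pullback along the
inverse of that chart. -/
def chartRepField (v : ∀ x : X, TangentSpace I x) (x₀ : X) (y : E) : E :=
  VectorField.mpullbackWithin 𝓘(ℝ, E) I (extChartAt I x₀).symm v (Set.range I) y

/-- The Lie derivative of a `1`-form on a normed space along a vector field,
`(L_V η)_y(w) = (D_{V(y)} η)(w) + η_y(D_w V)`; in coordinates this is
`(L_V η)_i = V^j ∂_j η_i + η_j ∂_i V^j`. -/
def lieDerivModel (V : E → E) (η : E → E [⋀^Fin 1]→L[ℝ] ℝ) (y : E) : E [⋀^Fin 1]→L[ℝ] ℝ :=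
  fderiv ℝ η y (V y) + (η y).compContinuousLinearMap (fderiv ℝ V y)

/-- The Lie derivative `L_v η` of a `1`-form along a vector field at the point `x`, computed in
the chart around `x`. -/
def lieDeriv (v : ∀ x : X, TangentSpace I x) (η : ∀ x : X, TangentSpace I x [⋀^Fin 1]→L[ℝ] ℝ)
    (x : X) : TangentSpace I x [⋀^Fin 1]→L[ℝ] ℝ :=
  (lieDerivModel (chartRepField I v x) (chartRep I η x) (extChartAt I x x)).compContinuousLinearMap
    (mfderiv I 𝓘(ℝ, E) (extChartAt I x) x)

variable {I} in
/-- A `2`-plectic structure: a closed and nondegenerate (smooth) `3`-form. -/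
structure IsTwoPlectic (ω₃ : Ω I X 3) : Prop where
  closed : ∀ x : X, extDerivAt I ω₃.1 x = 0
  nondegenerate : ∀ (x : X) (v : TangentSpace I x), interiorProduct I v (ω₃.1 x) = 0 → v = 0

theorem chartRep_differentiableAt [I.Boundaryless] {k : ℕ} (η : Ω I X k) (x : X) :
    DifferentiableAt ℝ (chartRep I η.1 x) (extChartAt I x x) :=
  ((η.2 x).contDiffAt (extChartAt_target_mem_nhds x)).differentiableAt (by simp)

theorem extDerivAt_add [I.Boundaryless] {k : ℕ} (η θ : Ω I X k) (x : X) :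
    extDerivAt I (η + θ).1 x = extDerivAt I η.1 x + extDerivAt I θ.1 x := by
  have h : chartRep I (η + θ).1 x = chartRep I η.1 x + chartRep I θ.1 x := rfl
  unfold extDerivAt
  rw [h, extDeriv_add (chartRep_differentiableAt I η x) (chartRep_differentiableAt I θ x)]
  rfl

theorem extDerivAt_smul {k : ℕ} (c : ℝ) (η : Ω I X k) (x : X) :
    extDerivAt I (c • η).1 x = c • extDerivAt I η.1 x := by
  have h : chartRep I (c • η).1 x = c • chartRep I η.1 x := rfl
  unfold extDerivAt
  rw [h, extDeriv_smul]
  rfl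

end Forms

section Hamiltonian

variable {E : Type*} [NormedAddCommGroup E] [NormedSpace ℝ E]
  {H : Type*} [TopologicalSpace H] {I : ModelWithCorners ℝ E H}
  {X : Type*} [TopologicalSpace X] [ChartedSpace H X] [IsManifold I ∞ X]

/-- The smooth vector field `v` is a Hamiltonian vector field of the `1`-form `F`:
`dF = -ι_v ω`. -/
def IsHamiltonianField (ω₃ : Ω I X 3)
    (F : ∀ x : X, TangentSpace I x [⋀^Fin 1]→L[ℝ] ℝ)
    (v : Cₛ^∞⟮I; E, (TangentSpace I : X → Type _)⟯) : Prop :=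
  ∀ x : X, extDerivAt I F x = -interiorProduct I (v x) (ω₃.1 x)

/-- The real vector space `Ham(X)` of Hamiltonian `1`-forms: the smooth `1`-forms that have a
smooth Hamiltonian vector field. -/
def Ham [I.Boundaryless] (ω₃ : Ω I X 3) :
    Submodule ℝ (∀ x : X, TangentSpace I x [⋀^Fin 1]→L[ℝ] ℝ) where
  carrier := {F | F ∈ Ω I X 1 ∧ ∃ v, IsHamiltonianField ω₃ F v}
  zero_mem' := ⟨(Ω I X 1).zero_mem, 0, fun x => by
    have h := extDerivAt_smul I (0 : ℝ) (0 : Ω I X 1) x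
    have h' := interiorProduct_smul I (0 : ℝ) (0 : TangentSpace I x) (ω₃.1 x)
    rw [smul_zero, zero_smul] at h h'
    rw [ContMDiffSection.coe_zero, Pi.zero_apply, h', neg_zero]
    exact h⟩
  add_mem' := by
    rintro F G ⟨hF, v, hv⟩ ⟨hG, w, hw⟩
    refine ⟨(Ω I X 1).add_mem hF hG, v + w, fun x => ?_⟩
    rw [ContMDiffSection.coe_add, Pi.add_apply, interiorProduct_add, neg_add, ← hv x, ← hw x]
    exact extDerivAt_add I ⟨F, hF⟩ ⟨G, hG⟩ x
  smul_mem' := by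
    rintro c F ⟨hF, v, hv⟩
    refine ⟨(Ω I X 1).smul_mem c hF, c • v, fun x => ?_⟩
    have h : extDerivAt I (c • F) x = c • extDerivAt I F x := extDerivAt_smul I c ⟨F, hF⟩ x
    rw [ContMDiffSection.coe_smul, Pi.smul_apply, interiorProduct_smul, h, hv x]
    ext u
    simp

/-- The Hamiltonian vector field `v_F` of a Hamiltonian `1`-form `F`. -/
def hamField [I.Boundaryless] {ω₃ : Ω I X 3} (F : Ham ω₃) :
    Cₛ^∞⟮I; E, (TangentSpace I : X → Type _)⟯ :=
  F.2.2.choose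

theorem hamField_spec [I.Boundaryless] {ω₃ : Ω I X 3} (F : Ham ω₃) :
    IsHamiltonianField ω₃ F.1 (hamField F) :=
  F.2.2.choose_spec

/-- On a `2`-plectic manifold the Hamiltonian vector field of `F` is unique, so `v_F` does not
depend on a choice. -/
theorem hamField_unique [I.Boundaryless] {ω₃ : Ω I X 3} (hω : IsTwoPlectic ω₃) (F : Ham ω₃)
    (v : Cₛ^∞⟮I; E, (TangentSpace I : X → Type _)⟯) (hv : IsHamiltonianField ω₃ F.1 v) :
    v = hamField F := by
  ext x
  have h : interiorProduct I (v x) (ω₃.1 x) = interiorProduct I (hamField F x) (ω₃.1 x) :=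
    neg_injective ((hv x).symm.trans (hamField_spec F x))
  refine sub_eq_zero.1 (hω.nondegenerate x _ ?_)
  rw [sub_eq_add_neg, ← neg_one_smul ℝ (hamField F x), interiorProduct_add, interiorProduct_smul, h]
  ext u
  simp

end Hamiltonian

end TwoPlectic

/-- A Lie 2-algebra whose underlying 2-term chain complex of vector spaces over `k` is
`L₀ ⟵ L₁`. Tensor products of complexes are the usual ones, so the bracket `L ⊗ L → L` has the
components `bracket : L₀ ⊗ L₀ → L₀`, `bracket₀₁ : L₀ ⊗ L₁ → L₁` and `bracket₁₀ : L₁ ⊗ L₀ → L₁`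
(on `L₁ ⊗ L₁` it takes values in `L₂ = 0`), and the chain homotopies `S` and `J`, of degree one,
have only a component on tensors of 0-chains. -/
structure Lie2Algebra (k : Type*) [Field k] (L₀ L₁ : Type*) [AddCommGroup L₀] [Module k L₀]
    [AddCommGroup L₁] [Module k L₁] where
  /-- the differential -/
  d : L₁ →ₗ[k] L₀
  /-- the bracket on 0-chains -/
  bracket : L₀ →ₗ[k] L₀ →ₗ[k] L₀
  /-- the bracket of a 0-chain and a 1-chain -/
  bracket₀₁ : L₀ →ₗ[k] L₁ →ₗ[k] L₁
  /-- the bracket of a 1-chain and a 0-chain -/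
  bracket₁₀ : L₁ →ₗ[k] L₀ →ₗ[k] L₁
  /-- the alternator -/
  S : L₀ →ₗ[k] L₀ →ₗ[k] L₁
  /-- the Jacobiator -/
  J : L₀ →ₗ[k] L₀ →ₗ[k] L₀ →ₗ[k] L₁
  /-
  The bracket is a chain map `L ⊗ L → L` (degrees 1, 1, 2).
  -/
  d_bracket₀₁ : ∀ x f, d (bracket₀₁ x f) = bracket x (d f)
  d_bracket₁₀ : ∀ f x, d (bracket₁₀ f x) = bracket (d f) x
  bracket_d_d : ∀ f g, bracket₀₁ (d f) g - bracket₁₀ f (d g) = 0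
  /-
  `S` is a chain homotopy `[·,·] ⇒ -[·,·] ∘ σ`, where `σ` is the switch (degrees 0, 1, 1).
  -/
  d_S : ∀ x y, bracket x y + d (S x y) = -bracket y x
  S_d_right : ∀ x f, bracket₀₁ x f + S x (d f) = -bracket₁₀ f x
  S_d_left : ∀ f x, bracket₁₀ f x + S (d f) x = -bracket₀₁ x f
  /-
  `J` is a chain homotopy `[·,[·,·]] ⇒ [[·,·],·] + [·,[·,·]] ∘ (σ ⊗ 1)` (degrees 0, 1, 1, 1).
  -/
  d_J : ∀ x y z,
    bracket x (bracket y z) + d (J x y z) = bracket (bracket x y) z + bracket y (bracket x z)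
  J_d_right : ∀ x y f, bracket₀₁ x (bracket₀₁ y f) + J x y (d f) =
    bracket₀₁ (bracket x y) f + bracket₀₁ y (bracket₀₁ x f)
  J_d_middle : ∀ x f z, bracket₀₁ x (bracket₁₀ f z) + J x (d f) z =
    bracket₁₀ (bracket₀₁ x f) z + bracket₁₀ f (bracket x z)
  J_d_left : ∀ f y z, bracket₁₀ f (bracket y z) + J (d f) y z =
    bracket₁₀ (bracket₁₀ f y) z + bracket₀₁ y (bracket₁₀ f z)
  /-
  `J` is antisymmetric.
  -/
  J_antisymm_left : ∀ x y z, J x y z = -J y x z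
  J_antisymm_right : ∀ x y z, J x y z = -J x z y
  /-
  The two ways of rebracketing `[w,[x,[y,z]]]` into
  `[[[w,x],y],z] + [y,[[w,x],z]] + [[x,[w,y]],z] + [[w,y],[x,z]] + [[x,y],[w,z]] + [y,[x,[w,z]]]`
  agree. Here and below a composite of 1-chains `x → y → z` is their sum.
  -/
  coherence_J : ∀ w x y z,
    bracket₀₁ w (J x y z) + (J w (bracket x y) z + J w y (bracket x z)) +
        (bracket₁₀ (J w x y) z + bracket₀₁ y (J w x z)) =
      J w x (bracket y z) + (J (bracket w x) y z + bracket₀₁ x (J w y z)) +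
        (J x (bracket w y) z + J x y (bracket w z))
  /-
  `[[x,y],z] → -[[y,x],z] → [x,[y,z]] - [y,[x,z]]` agrees with
  `[[x,y],z] → [x,[y,z]] - [y,[x,z]]`.
  -/
  coherence_S_left : ∀ x y z, bracket₁₀ (S x y) z + J y x z = -J x y z
  /-
  `[x,[y,z]] → -[x,[z,y]] → -[[x,z],y] - [z,[x,y]]` agrees with
  `[x,[y,z]] → [[x,y],z] + [y,[x,z]] → -[[x,z],y] - [z,[x,y]]`.
  -/
  coherence_S_right : ∀ x y z,
    bracket₀₁ x (S y z) + -J x z y = J x y z + (S (bracket x y) z + S y (bracket x z))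
  /-
  `[x,[y,z]] → -[[y,z],x] → [x,[y,z]]` is the identity.
  -/
  coherence_S_symm : ∀ x y z, S x (bracket y z) + -S (bracket y z) x = 0

/-- A Lie 2-algebra is hemistrict if its Jacobiator is the identity chain homotopy. -/
def Lie2Algebra.IsHemistrict {k : Type*} [Field k] {L₀ L₁ : Type*} [AddCommGroup L₀] [Module k L₀]
    [AddCommGroup L₁] [Module k L₁] (L : Lie2Algebra k L₀ L₁) : Prop :=
  ∀ x y z, L.J x y z = 0

end

/-! The theorem is Cartan calculus plus one fact about ω. Three identities are needed for vector
fields `v`, `w` and a 1-form `η`: `L_v η = ι_v dη + d ι_v η` (`lieDeriv_eq`), `[L_v, L_w] η =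
L_{[v,w]} η` (`lieForm_lieForm`), and `v(ι_w η) = ι_{[v,w]} η + ι_w L_v η`
(`pairingMap_dForm_pairingMap`). The fact about ω is that `[v_F, v_G]` is a Hamiltonian field of
`L_{v_F} G` (`isHamiltonianField_lieForm`): by Cartan, `L_{v_F} G` is `-ι_{v_F} ι_{v_G} ω` up to an
exact form, and ω and its contractions with `v_F` and `v_G` are all closed. Nondegeneracy then gives
`v_{{F,G}} = [v_F, v_G]`.

The axioms follow. The Jacobi identity is the commutator formula and holds strictly, so `J = 0`. The
part `-ι_{v_F} ι_{v_G} ω` is skew, so the symmetrised bracket is `d(ι_{v_F} G + ι_{v_G} F)`, which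
dictates `S`. Exact forms have zero Hamiltonian field, which allows `{f, F} = 0`. The coherence law
for `S` that is not formal is the Leibniz rule used twice.

Both derivatives are defined at each point in the chart centred there. They are first shown to have
the same formula in every chart; identities are then checked in the model space. -/

namespace TwoPlectic

open ContinuousAlternatingMap VectorField

/-! ### Forms and vector fields on a normed space. -/

section Model

variable {E : Type*} [NormedAddCommGroup E] [NormedSpace ℝ E]

theorem extDeriv_apply_one (η : E → E [⋀^Fin 1]→L[ℝ] ℝ) (y u v : E) :
    extDeriv η y ![u, v] = fderiv ℝ η y u ![v] - fderiv ℝ η y v ![u] := by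
  have h₁ : Fin.removeNth 1 ![u, v] = ![u] := by ext i; fin_cases i; rfl
  have h₀ : Fin.removeNth 0 ![u, v] = ![v] := by ext i; fin_cases i; rfl
  simp [extDeriv, alternatizeUncurryFin_apply, Fin.sum_univ_succ, h₀, h₁, sub_eq_add_neg]

theorem extDeriv_apply_two (η : E → E [⋀^Fin 2]→L[ℝ] ℝ) (y u v w : E) :
    extDeriv η y ![u, v, w] =
      fderiv ℝ η y u ![v, w] - fderiv ℝ η y v ![u, w] + fderiv ℝ η y w ![u, v] := by
  have h₀ : Fin.removeNth 0 ![u, v, w] = ![v, w] := by ext i; fin_cases i <;> rfl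
  have h₁ : Fin.removeNth 1 ![u, v, w] = ![u, w] := by ext i; fin_cases i <;> rfl
  have h₂ : Fin.removeNth 2 ![u, v, w] = ![u, v] := by ext i; fin_cases i <;> rfl
  simp [extDeriv, alternatizeUncurryFin_apply, Fin.sum_univ_succ, h₀, h₁, h₂]
  ring

theorem extDeriv_apply_three (η : E → E [⋀^Fin 3]→L[ℝ] ℝ) (y u v w x : E) :
    extDeriv η y ![u, v, w, x] =
      fderiv ℝ η y u ![v, w, x] - fderiv ℝ η y v ![u, w, x] + fderiv ℝ η y w ![u, v, x] -
        fderiv ℝ η y x ![u, v, w] := by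
  have h₀ : Fin.removeNth 0 ![u, v, w, x] = ![v, w, x] := by ext i; fin_cases i <;> rfl
  have h₁ : Fin.removeNth 1 ![u, v, w, x] = ![u, w, x] := by ext i; fin_cases i <;> rfl
  have h₂ : Fin.removeNth 2 ![u, v, w, x] = ![u, v, x] := by ext i; fin_cases i <;> rfl
  have h₃ : Fin.removeNth 3 ![u, v, w, x] = ![u, v, w] := by ext i; fin_cases i <;> rfl
  simp [extDeriv, alternatizeUncurryFin_apply, Fin.sum_univ_succ, h₀, h₁, h₂, h₃]
  ring

/-- Currying is an isometry, hence the bound 1. Differentiability, smoothness and the product rule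
for contractions all come from this. -/
theorem isBoundedBilinearMap_curryLeft (k : ℕ) :
    IsBoundedBilinearMap ℝ (fun p : (E [⋀^Fin (k + 1)]→L[ℝ] ℝ) × E => p.1.curryLeft p.2) where
  add_left _ _ _ := rfl
  smul_left _ _ _ := rfl
  add_right _ _ _ := map_add _ _ _
  smul_right _ _ _ := map_smul _ _ _
  bound := ⟨1, one_pos, fun α v => by
    rw [one_mul, ← norm_curryLeft]
    exact ContinuousLinearMap.le_opNorm _ _⟩

theorem differentiableAt_curryLeft {k : ℕ} {α : E → E [⋀^Fin (k + 1)]→L[ℝ] ℝ} {V : E → E} {y : E}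
    (hα : DifferentiableAt ℝ α y) (hV : DifferentiableAt ℝ V y) :
    DifferentiableAt ℝ (fun z => (α z).curryLeft (V z)) y := by
  have h := ((isBoundedBilinearMap_curryLeft k).differentiableAt (α y, V y)).comp y (hα.prodMk hV)
  exact h

theorem fderiv_curryLeft {k : ℕ} {α : E → E [⋀^Fin (k + 1)]→L[ℝ] ℝ} {V : E → E} {y : E}
    (hα : DifferentiableAt ℝ α y) (hV : DifferentiableAt ℝ V y) (u : E) :
    fderiv ℝ (fun z => (α z).curryLeft (V z)) y u =
      (fderiv ℝ α y u).curryLeft (V y) + (α y).curryLeft (fderiv ℝ V y u) := by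
  have h := ((isBoundedBilinearMap_curryLeft k).hasFDerivAt (α y, V y)).comp y
    (hα.hasFDerivAt.prodMk hV.hasFDerivAt)
  refine (congrArg (fun L : E →L[ℝ] E [⋀^Fin k]→L[ℝ] ℝ => L u) h.fderiv).trans ?_
  exact add_comm _ _

theorem contDiffOn_curryLeft {k : ℕ} {n : WithTop ℕ∞} {α : E → E [⋀^Fin (k + 1)]→L[ℝ] ℝ}
    {V : E → E} {s : Set E} (hα : ContDiffOn ℝ n α s) (hV : ContDiffOn ℝ n V s) :
    ContDiffOn ℝ n (fun z => (α z).curryLeft (V z)) s := by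
  have h := (isBoundedBilinearMap_curryLeft (E := E) k).contDiff (n := n) |>.comp_contDiffOn
    (hα.prodMk hV)
  exact h

theorem fderiv_apply_const_apply {k : ℕ} {η : E → E [⋀^Fin k]→L[ℝ] ℝ} {y : E}
    (hη : DifferentiableAt ℝ η y) (v : Fin k → E) (u : E) :
    fderiv ℝ (fun z => η z v) y u = fderiv ℝ η y u v :=
  fderiv_continuousAlternatingMap_apply_const_apply hη v u

theorem fderiv_apply_vecSingle {η : E → E [⋀^Fin 1]→L[ℝ] ℝ} {V : E → E} {y : E}
    (hη : DifferentiableAt ℝ η y) (hV : DifferentiableAt ℝ V y) (u : E) :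
    fderiv ℝ (fun z => η z ![V z]) y u = fderiv ℝ η y u ![V y] + η y ![fderiv ℝ V y u] := by
  -- Evaluation on one vector is contraction to a 0-form followed by evaluation on the empty tuple.
  exact (fderiv_apply_const_apply (differentiableAt_curryLeft hη hV) ![] u).trans
    (congrArg (fun β : E [⋀^Fin 0]→L[ℝ] ℝ => β ![]) (fderiv_curryLeft hη hV u))

theorem lieDerivModel_apply (V : E → E) (η : E → E [⋀^Fin 1]→L[ℝ] ℝ) (y u : E) :
    lieDerivModel V η y ![u] = fderiv ℝ η y (V y) ![u] + η y ![fderiv ℝ V y u] := by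
  rw [lieDerivModel, ContinuousAlternatingMap.add_apply, compContinuousLinearMap_apply]
  congr 2
  ext i
  fin_cases i
  rfl

theorem ext_vecSingle {α β : E [⋀^Fin 1]→L[ℝ] ℝ} (h : ∀ u, α ![u] = β ![u]) : α = β := by
  ext v
  have hv : v = ![v 0] := by ext i; fin_cases i; rfl
  rw [hv, h]

/-- Cartan's formula for 1-forms. -/
theorem lieDerivModel_eq {V : E → E} {η : E → E [⋀^Fin 1]→L[ℝ] ℝ} {y : E}
    (hη : DifferentiableAt ℝ η y) (hV : DifferentiableAt ℝ V y) :
    lieDerivModel V η y = (extDeriv η y).curryLeft (V y) +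
      ofSubsingleton ℝ E ℝ (0 : Fin 1) (fderiv ℝ (fun z => η z ![V z]) y) := by
  refine ext_vecSingle fun u => ?_
  rw [lieDerivModel_apply, ContinuousAlternatingMap.add_apply, curryLeft_apply_apply,
    extDeriv_apply_one, ofSubsingleton_apply_apply]
  simp only [Matrix.cons_val_zero, fderiv_apply_vecSingle hη hV]
  -- The terms `(D_u η)(V)` of `ι_V dη` and of `d(η(V))` cancel.
  ring

/-- If `α`, `ι_A α` and `ι_B α` are closed, then `d(ι_B ι_A α) = -ι_{[A, B]} α`. -/
theorem extDeriv_curryLeft_curryLeft {α : E → E [⋀^Fin 3]→L[ℝ] ℝ} {A B : E → E} {y : E}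
    (hα : DifferentiableAt ℝ α y) (hA : DifferentiableAt ℝ A y) (hB : DifferentiableAt ℝ B y)
    (dα : extDeriv α y = 0) (dA : extDeriv (fun z => (α z).curryLeft (A z)) y = 0)
    (dB : extDeriv (fun z => (α z).curryLeft (B z)) y = 0) :
    extDeriv (fun z => ((α z).curryLeft (A z)).curryLeft (B z)) y =
      -(α y).curryLeft (lieBracket ℝ A B y) := by
  ext v
  have hv : v = ![v 0, v 1] := by ext i; fin_cases i <;> rfl
  generalize v 0 = u at hv
  generalize v 1 = w at hv
  subst hv
  -- Each closedness hypothesis is evaluated on the one tuple that involves `A`, `B`, `u`, `w`.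
  have e₁ : extDeriv α y ![A y, B y, u, w] = 0 := by rw [dα]; rfl
  have e₂ : extDeriv (fun z => (α z).curryLeft (A z)) y ![B y, u, w] = 0 := by rw [dA]; rfl
  have e₃ : extDeriv (fun z => (α z).curryLeft (B z)) y ![A y, u, w] = 0 := by rw [dB]; rfl
  have swap (β : E [⋀^Fin 3]→L[ℝ] ℝ) (a b c : E) : β ![b, a, c] = -β ![a, b, c] := by
    have h := β.map_swap ![a, b, c] (i := 0) (j := 1) (by decide)
    refine Eq.trans (congrArg β ?_) h
    ext i
    fin_cases i <;> rfl
  simp only [extDeriv_apply_three, extDeriv_apply_two, fderiv_curryLeft hα hA,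
    fderiv_curryLeft hα hB, ContinuousAlternatingMap.add_apply, curryLeft_apply_apply] at e₁ e₂ e₃
  rw [extDeriv_apply_one, fderiv_curryLeft (differentiableAt_curryLeft hα hA) hB,
    fderiv_curryLeft (differentiableAt_curryLeft hα hA) hB, fderiv_curryLeft hα hA,
    fderiv_curryLeft hα hA]
  simp only [ContinuousAlternatingMap.add_apply, curryLeft_apply_apply, lieBracket,
    map_sub, ContinuousAlternatingMap.neg_apply, ContinuousAlternatingMap.sub_apply]
  rw [swap _ (A y) (B y), swap _ (A y) (B y), swap _ (A y) (fderiv ℝ B y u),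
    swap _ (A y) (fderiv ℝ B y w)] at e₃
  -- With `A` now before `B` throughout, the goal is `e₃ - e₂ - e₁`: the derivatives of `α` along
  -- `A` and `B` drop out and `α([A, B], u, w)` remains.
  linarith

theorem fderiv_fderiv_comm {F : Type*} [NormedAddCommGroup F] [NormedSpace ℝ F] {V : E → F} {y : E}
    (hV : ContDiffAt ℝ 2 V y) (u v : E) :
    fderiv ℝ (fderiv ℝ V) y u v = fderiv ℝ (fderiv ℝ V) y v u :=
  (hV.isSymmSndFDerivAt (by simp)) u v

theorem differentiableAt_fderiv {F : Type*} [NormedAddCommGroup F] [NormedSpace ℝ F] {V : E → F}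
    {y : E} (hV : ContDiffAt ℝ 2 V y) : DifferentiableAt ℝ (fderiv ℝ V) y :=
  (hV.fderiv_right (m := 1) (by norm_num)).differentiableAt (by simp)

theorem lieDerivModel_lieDerivModel_apply {V W : E → E} {η : E → E [⋀^Fin 1]→L[ℝ] ℝ} {y : E}
    (hη : ContDiffAt ℝ 2 η y) (hW : ContDiffAt ℝ 2 W y) (u : E) :
    lieDerivModel V (lieDerivModel W η) y ![u] =
      fderiv ℝ (fderiv ℝ η) y (V y) (W y) ![u] + fderiv ℝ η y (fderiv ℝ W y (V y)) ![u] +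
        fderiv ℝ η y (V y) ![fderiv ℝ W y u] + η y ![fderiv ℝ (fderiv ℝ W) y (V y) u] +
        (fderiv ℝ η y (W y) ![fderiv ℝ V y u] + η y ![fderiv ℝ W y (fderiv ℝ V y u)]) := by
  have hη' := hη.differentiableAt (by simp)
  have hW' := hW.differentiableAt (by simp)
  have hdη := differentiableAt_fderiv hη
  have hdW := differentiableAt_fderiv hW
  have h₁ : DifferentiableAt ℝ (fun z => fderiv ℝ η z (W z)) y := hdη.clm_apply hW'
  have h₂ : DifferentiableAt ℝ (fun z => fderiv ℝ W z u) y :=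
    hdW.clm_apply (differentiableAt_const u)
  have h : DifferentiableAt ℝ (lieDerivModel W η) y :=
    h₁.add (hη'.continuousAlternatingMapCompContinuousLinearMap hdW)
  have hzero (β : E [⋀^Fin 1]→L[ℝ] ℝ) : β ![0] = 0 := β.map_coord_zero 0 rfl
  -- Evaluation at the constant `u` commutes with differentiation, the extra term being a form
  -- evaluated at `0`; only scalar functions are left to differentiate.
  have key : fderiv ℝ (lieDerivModel W η) y (V y) ![u] =
      fderiv ℝ (fun z => lieDerivModel W η z ![u]) y (V y) := by
    simpa [hzero] using (fderiv_apply_vecSingle h (differentiableAt_const u) (V y)).symm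
  rw [lieDerivModel_apply, lieDerivModel_apply, key]
  simp only [lieDerivModel_apply]
  have h₃ : DifferentiableAt ℝ (fun z => fderiv ℝ η z (W z) ![u]) y :=
    (differentiableAt_curryLeft h₁ (differentiableAt_const u)).continuousAlternatingMap_apply
      (g := fun i _ => (![] : Fin 0 → E) i) (fun i => i.elim0)
  have h₄ : DifferentiableAt ℝ (fun z => η z ![fderiv ℝ W z u]) y :=
    (differentiableAt_curryLeft hη' h₂).continuousAlternatingMap_apply
      (g := fun i _ => (![] : Fin 0 → E) i) (fun i => i.elim0)
  rw [fderiv_fun_add h₃ h₄, _root_.add_apply, fderiv_apply_vecSingle hη' h₂,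
    fderiv_apply_vecSingle h₁ (differentiableAt_const u), fderiv_clm_apply hdη hW',
    fderiv_clm_apply hdW (differentiableAt_const u)]
  simp [hzero]
  ring

/-- Symmetry of second derivatives does the work: `D²η(V, W)` is common to both orders, while
`D²W(V, u)` and `D²V(W, u)` are the second-order terms in the derivative of `[V, W]`. -/
theorem lieDerivModel_lieBracket {V W : E → E} {η : E → E [⋀^Fin 1]→L[ℝ] ℝ} {y : E}
    (hη : ContDiffAt ℝ 2 η y) (hV : ContDiffAt ℝ 2 V y) (hW : ContDiffAt ℝ 2 W y) :
    lieDerivModel V (lieDerivModel W η) y =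
      lieDerivModel (lieBracket ℝ V W) η y + lieDerivModel W (lieDerivModel V η) y := by
  have hV' := hV.differentiableAt (by simp)
  have hW' := hW.differentiableAt (by simp)
  have hdV := differentiableAt_fderiv hV
  have hdW := differentiableAt_fderiv hW
  have hbr (u : E) : fderiv ℝ (lieBracket ℝ V W) y u =
      fderiv ℝ (fderiv ℝ W) y u (V y) + fderiv ℝ W y (fderiv ℝ V y u) -
        (fderiv ℝ (fderiv ℝ V) y u (W y) + fderiv ℝ V y (fderiv ℝ W y u)) := by
    have : lieBracket ℝ V W = fun z => fderiv ℝ W z (V z) - fderiv ℝ V z (W z) := rfl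
    rw [this, fderiv_fun_sub (hdW.clm_apply hV') (hdV.clm_apply hW'), fderiv_clm_apply hdW hV',
      fderiv_clm_apply hdV hW']
    simp
    abel
  have hadd (a b : E) : η y ![a + b] = η y ![a] + η y ![b] := (η y).map_vecCons_add ![] a b
  have hsub (a b : E) : η y ![a - b] = η y ![a] - η y ![b] :=
    eq_sub_of_add_eq ((hadd _ _).symm.trans (by rw [sub_add_cancel]))
  refine ext_vecSingle fun u => ?_
  rw [ContinuousAlternatingMap.add_apply, lieDerivModel_lieDerivModel_apply hη hW,
    lieDerivModel_lieDerivModel_apply hη hV, lieDerivModel_apply, hbr, fderiv_fderiv_comm hη,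
    fderiv_fderiv_comm hV, fderiv_fderiv_comm hW]
  simp only [lieBracket, hsub, hadd, map_sub, ContinuousAlternatingMap.sub_apply]
  ring

end Model

/-- Over `ℝ` the smoothness required for symmetric second derivatives is just `2`. -/
theorem minSmoothness_two_le : minSmoothness ℝ 2 ≤ ∞ := by
  rw [minSmoothness_of_isRCLikeNormedField]
  exact WithTop.coe_le_coe.2 le_top

/-! ### Basic facts about chart expressions. -/

section ChartsBasic

variable {E : Type*} [NormedAddCommGroup E] [NormedSpace ℝ E]
  {H : Type*} [TopologicalSpace H] {I : ModelWithCorners ℝ E H} [I.Boundaryless]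
  {X : Type*} [TopologicalSpace X] [ChartedSpace H X]

theorem eventually_mem_target {x₀ : X} {y : E} (hy : y ∈ (extChartAt I x₀).target) :
    ∀ᶠ z in nhds y, z ∈ (extChartAt I x₀).target :=
  (isOpen_extChartAt_target x₀).mem_nhds hy

theorem chartRepField_eq_mpullback (v : ∀ x : X, TangentSpace I x) (x₀ : X) :
    chartRepField I v x₀ = mpullback 𝓘(ℝ, E) I (extChartAt I x₀).symm v := by
  ext y
  rw [chartRepField, I.range_eq_univ, mpullbackWithin_univ]

theorem contMDiff_of_contDiffOn {f : X → ℝ}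
    (h : ∀ x₀ : X, ContDiffOn ℝ ∞ (f ∘ (extChartAt I x₀).symm) (extChartAt I x₀).target) :
    ContMDiff I 𝓘(ℝ, ℝ) ∞ f := by
  intro x
  have h₁ : ContMDiffAt I 𝓘(ℝ, ℝ) ∞ ((f ∘ (extChartAt I x).symm) ∘ extChartAt I x) x :=
    ContMDiffAt.comp x ((h x).contDiffAt (extChartAt_target_mem_nhds x)).contMDiffAt
      contMDiffAt_extChartAt
  refine h₁.congr_of_eventuallyEq ?_
  filter_upwards [extChartAt_source_mem_nhds (I := I) x] with z hz
  exact congrArg f ((extChartAt I x).left_inv hz).symm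

theorem chartRep_contDiffAt {k : ℕ} (η : Ω I X k) {x₀ : X} {y : E}
    (hy : y ∈ (extChartAt I x₀).target) : ContDiffAt ℝ ∞ (chartRep I η.1 x₀) y :=
  (η.2 x₀).contDiffAt (eventually_mem_target hy)

end ChartsBasic

/-! ### Chart independence and smoothness of `d`, `ι_v` and `L_v`. -/

section Charts

variable {E : Type*} [NormedAddCommGroup E] [NormedSpace ℝ E]
  {H : Type*} [TopologicalSpace H] {I : ModelWithCorners ℝ E H}
  {X : Type*} [TopologicalSpace X] [ChartedSpace H X] [IsManifold I ∞ X]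

/-- The pullback of a field applies the inverse of the derivative of the inverse chart, and that
derivative is invertible on the target. -/
theorem mfderivWithin_chartRepField (v : ∀ x : X, TangentSpace I x) {x₀ : X} {y : E}
    (hy : y ∈ (extChartAt I x₀).target) :
    mfderivWithin 𝓘(ℝ, E) I (extChartAt I x₀).symm (Set.range I) y (chartRepField I v x₀ y : E) =
      v ((extChartAt I x₀).symm y) :=
  congrArg (fun L : TangentSpace I ((extChartAt I x₀).symm y) →L[ℝ] _ => L (v _))
    (isInvertible_mfderivWithin_extChartAt_symm hy).self_comp_inverse

theorem chartRep_interiorProduct {k : ℕ} (v : ∀ x : X, TangentSpace I x)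
    (η : ∀ x : X, TangentSpace I x [⋀^Fin (k + 1)]→L[ℝ] ℝ) {x₀ : X} {y : E}
    (hy : y ∈ (extChartAt I x₀).target) :
    chartRep I (fun x => interiorProduct I (v x) (η x)) x₀ y =
      (chartRep I η x₀ y).curryLeft (chartRepField I v x₀ y) := by
  ext u
  refine congrArg (η ((extChartAt I x₀).symm y)) ?_
  funext i
  refine Fin.cases ?_ (fun j => rfl) i
  exact (mfderivWithin_chartRepField v hy).symm

theorem chartRep_apply_chartRepField (v : ∀ x : X, TangentSpace I x)
    (η : ∀ x : X, TangentSpace I x [⋀^Fin 1]→L[ℝ] ℝ) {x₀ : X} {y : E}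
    (hy : y ∈ (extChartAt I x₀).target) :
    chartRep I η x₀ y ![chartRepField I v x₀ y] =
      pairing I (v ((extChartAt I x₀).symm y)) (η ((extChartAt I x₀).symm y)) := by
  refine congrArg (η ((extChartAt I x₀).symm y)) ?_
  funext i
  fin_cases i
  exact mfderivWithin_chartRepField v hy

theorem chartRep_compContinuousLinearMap {k : ℕ}
    (η : ∀ x : X, TangentSpace I x [⋀^Fin k]→L[ℝ] ℝ) {x₀ x : X}
    (hx : x ∈ (extChartAt I x₀).source) :
    (chartRep I η x₀ (extChartAt I x₀ x)).compContinuousLinearMap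
      (mfderiv I 𝓘(ℝ, E) (extChartAt I x₀) x) = η x := by
  -- Writing `x` as the image of `y` avoids transport between tangent spaces at points that are only
  -- propositionally equal.
  obtain ⟨y, hy, rfl⟩ : ∃ y ∈ (extChartAt I x₀).target, (extChartAt I x₀).symm y = x :=
    ⟨_, (extChartAt I x₀).map_source hx, (extChartAt I x₀).left_inv hx⟩
  rw [(extChartAt I x₀).right_inv hy]
  ext u
  refine congrArg (η ((extChartAt I x₀).symm y)) ?_
  funext i
  exact congrArg (fun L => L (u i)) (mfderivWithin_extChartAt_symm_comp_mfderiv_extChartAt hy)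

/-- A form at `x` is recovered from its chart expression, so identities on `X` can be tested at the
centre of one chart. -/
theorem eq_of_chartRep_eq {k : ℕ} {η θ : ∀ x : X, TangentSpace I x [⋀^Fin k]→L[ℝ] ℝ} {x : X}
    (h : chartRep I η x (extChartAt I x x) = chartRep I θ x (extChartAt I x x)) : η x = θ x := by
  rw [← chartRep_compContinuousLinearMap η (mem_extChartAt_source x),
    ← chartRep_compContinuousLinearMap θ (mem_extChartAt_source x), h]

variable [I.Boundaryless]

theorem contMDiffAt_extChartAt_symm {x₀ : X} {y : E} (hy : y ∈ (extChartAt I x₀).target) :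
    ContMDiffAt 𝓘(ℝ, E) I ∞ (extChartAt I x₀).symm y :=
  (contMDiffOn_extChartAt_symm x₀).contMDiffAt ((isOpen_extChartAt_target x₀).mem_nhds hy)

theorem fderiv_extChartAt_comp_symm {x₀ x₁ : X} {y : E}
    (hy : y ∈ (extChartAt I x₀).target) (hy' : (extChartAt I x₀).symm y ∈ (extChartAt I x₁).source) :
    fderiv ℝ (extChartAt I x₁ ∘ (extChartAt I x₀).symm) y =
      (mfderiv I 𝓘(ℝ, E) (extChartAt I x₁) ((extChartAt I x₀).symm y)).comp
        (mfderivWithin 𝓘(ℝ, E) I (extChartAt I x₀).symm (Set.range I) y) := by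
  rw [← mfderiv_eq_fderiv, I.range_eq_univ, mfderivWithin_univ]
  exact mfderiv_comp y (mdifferentiableAt_extChartAt (by simpa using hy'))
    ((contMDiffAt_extChartAt_symm hy).mdifferentiableAt (by simp))

theorem chartRep_eq_compContinuousLinearMap {k : ℕ}
    (η : ∀ x : X, TangentSpace I x [⋀^Fin k]→L[ℝ] ℝ) {x₀ x₁ : X} {y : E}
    (hy : y ∈ (extChartAt I x₀).target) (hy' : (extChartAt I x₀).symm y ∈ (extChartAt I x₁).source) :
    chartRep I η x₀ y =
      (chartRep I η x₁ (extChartAt I x₁ ((extChartAt I x₀).symm y))).compContinuousLinearMap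
        (fderiv ℝ (extChartAt I x₁ ∘ (extChartAt I x₀).symm) y) := by
  rw [fderiv_extChartAt_comp_symm hy hy', chartRep, ← chartRep_compContinuousLinearMap η hy']
  rfl

/-- The exterior derivative can be computed in any chart. -/
theorem chartRep_extDerivAt {k : ℕ} (η : Ω I X k) {x₀ : X} {y : E}
    (hy : y ∈ (extChartAt I x₀).target) :
    chartRep I (extDerivAt I η.1) x₀ y = extDeriv (chartRep I η.1 x₀) y := by
  have hmem := mem_extChartAt_source (I := I) ((extChartAt I x₀).symm y)
  have hτ : ContDiffAt ℝ ∞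
      (extChartAt I ((extChartAt I x₀).symm y) ∘ (extChartAt I x₀).symm) y :=
    (ContMDiffAt.comp y contMDiffAt_extChartAt (contMDiffAt_extChartAt_symm hy)).contDiffAt
  have hd : DifferentiableAt ℝ (chartRep I η.1 ((extChartAt I x₀).symm y))
      ((extChartAt I ((extChartAt I x₀).symm y) ∘ (extChartAt I x₀).symm) y) :=
    chartRep_differentiableAt I η _
  -- Near `y` the two chart expressions differ by pullback along the transition map, and `d`
  -- commutes with pullback.
  have hev : chartRep I η.1 x₀ =ᶠ[nhds y] fun z =>
      (chartRep I η.1 ((extChartAt I x₀).symm y) ((extChartAt I ((extChartAt I x₀).symm y) ∘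
        (extChartAt I x₀).symm) z)).compContinuousLinearMap
          (fderiv ℝ (extChartAt I ((extChartAt I x₀).symm y) ∘ (extChartAt I x₀).symm) z) := by
    filter_upwards [eventually_mem_target hy,
      (contMDiffAt_extChartAt_symm hy).continuousAt.preimage_mem_nhds
        (extChartAt_source_mem_nhds (I := I) ((extChartAt I x₀).symm y))] with z hz hz'
    exact chartRep_eq_compContinuousLinearMap η.1 hz hz'
  rw [hev.extDeriv_eq, extDeriv_pullback hd hτ minSmoothness_two_le, fderiv_extChartAt_comp_symm hy hmem]
  rfl

theorem extDerivAt_mem {k : ℕ} (η : Ω I X k) : extDerivAt I η.1 ∈ Ω I X (k + 1) := by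
  intro x₀
  have h : ContDiffOn ℝ ∞ (fderiv ℝ (chartRep I η.1 x₀)) (extChartAt I x₀).target :=
    (η.2 x₀).fderiv_of_isOpen (isOpen_extChartAt_target x₀) (by simp)
  have h' : ContDiffOn ℝ ∞ (extDeriv (chartRep I η.1 x₀)) (extChartAt I x₀).target := by
    have h₀ := ContinuousLinearMap.contDiff (𝕜 := ℝ) (E := E →L[ℝ] E [⋀^Fin k]→L[ℝ] ℝ)
      (F := E [⋀^Fin (k + 1)]→L[ℝ] ℝ) (n := ∞) (alternatizeUncurryFinCLM ℝ E ℝ)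
    exact h₀.comp_contDiffOn h
  exact h'.congr fun y hy => chartRep_extDerivAt η hy

theorem chartRep_dFun {f : X → ℝ} {x₀ : X} {y : E} (hy : y ∈ (extChartAt I x₀).target)
    (hf : MDifferentiableAt I 𝓘(ℝ, ℝ) f ((extChartAt I x₀).symm y)) :
    chartRep I (dFun I f) x₀ y =
      ofSubsingleton ℝ E ℝ (0 : Fin 1) (fderiv ℝ (f ∘ (extChartAt I x₀).symm) y) := by
  rw [← mfderiv_eq_fderiv,
    mfderiv_comp y hf ((contMDiffAt_extChartAt_symm hy).mdifferentiableAt (by simp)),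
    chartRep, I.range_eq_univ, mfderivWithin_univ]
  rfl

theorem contDiffOn_chartRepField [CompleteSpace E]
    (v : Cₛ^∞⟮I; E, (TangentSpace I : X → Type _)⟯) (x₀ : X) :
    ContDiffOn ℝ ∞ (chartRepField I v x₀) (extChartAt I x₀).target := by
  intro y hy
  refine ContDiffAt.contDiffWithinAt ?_
  rw [chartRepField_eq_mpullback]
  refine contMDiffAt_vectorSpace_iff_contDiffAt.1 ?_
  refine ContMDiffAt.mpullback_vectorField_preimage (n := ∞) (v.contMDiff _)
    (contMDiffAt_extChartAt_symm hy) ?_ (by simp)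
  rw [← mfderivWithin_univ, ← I.range_eq_univ]
  exact isInvertible_mfderivWithin_extChartAt_symm hy

theorem chartRepField_contDiffAt [CompleteSpace E]
    (v : Cₛ^∞⟮I; E, (TangentSpace I : X → Type _)⟯) {x₀ : X} {y : E}
    (hy : y ∈ (extChartAt I x₀).target) : ContDiffAt ℝ ∞ (chartRepField I v x₀) y :=
  (contDiffOn_chartRepField v x₀).contDiffAt (eventually_mem_target hy)

theorem chartRepField_mlieBracket [CompleteSpace E]
    (v w : Cₛ^∞⟮I; E, (TangentSpace I : X → Type _)⟯) {x₀ : X} {y : E}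
    (hy : y ∈ (extChartAt I x₀).target) :
    chartRepField I (mlieBracket I v w) x₀ y =
      lieBracket ℝ (chartRepField I v x₀) (chartRepField I w x₀) y := by
  have : IsManifold I (minSmoothness ℝ 2) X := IsManifold.of_le minSmoothness_two_le
  rw [chartRepField_eq_mpullback, chartRepField_eq_mpullback, chartRepField_eq_mpullback,
    mpullback_mlieBracket ((v.contMDiff _).mdifferentiableAt (by simp))
      ((w.contMDiff _).mdifferentiableAt (by simp)) (contMDiffAt_extChartAt_symm hy) minSmoothness_two_le,
    ← mlieBracketWithin_univ, mlieBracketWithin_eq_lieBracketWithin]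
  exact congrFun lieBracketWithin_univ y

/-- The Lie bracket of two smooth vector fields as a smooth vector field. -/
noncomputable def fieldBracket [CompleteSpace E] (v w : Cₛ^∞⟮I; E, (TangentSpace I : X → Type _)⟯) :
    Cₛ^∞⟮I; E, (TangentSpace I : X → Type _)⟯ where
  toFun := mlieBracket I v w
  contMDiff_toFun := by
    have : IsManifold I (minSmoothness ℝ 2) X := IsManifold.of_le minSmoothness_two_le
    -- The bracket loses one derivative, which costs nothing here because `∞ + 1` is `∞`.
    have : IsManifold I (((⊤ : ℕ∞) : WithTop ℕ∞) + 1) X := ‹IsManifold I ∞ X›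
    exact ContDiff.mlieBracket_vectorField (m := ⊤) (n := ⊤) v.contMDiff w.contMDiff (by simp)

theorem contDiffOn_comp_extChartAt_symm {f : X → ℝ} (h : ContMDiff I 𝓘(ℝ, ℝ) ∞ f) (x₀ : X) :
    ContDiffOn ℝ ∞ (f ∘ (extChartAt I x₀).symm) (extChartAt I x₀).target := fun y hy =>
  (ContMDiffAt.comp y (h _) (contMDiffAt_extChartAt_symm hy)).contDiffAt.contDiffWithinAt

theorem contMDiff_pairing [CompleteSpace E] (v : Cₛ^∞⟮I; E, (TangentSpace I : X → Type _)⟯)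
    (η : Ω I X 1) : ContMDiff I 𝓘(ℝ, ℝ) ∞ (fun x => pairing I (v x) (η.1 x)) := by
  refine contMDiff_of_contDiffOn fun x₀ => ?_
  have h := contDiffOn_curryLeft (η.2 x₀) (contDiffOn_chartRepField v x₀)
  have h' : ContDiffOn ℝ ∞ (fun y => chartRep I η.1 x₀ y ![chartRepField I v x₀ y])
      (extChartAt I x₀).target :=
    (apply ℝ E ℝ (![] : Fin 0 → E)).contDiff.comp_contDiffOn h
  exact h'.congr fun y hy => (chartRep_apply_chartRepField v η.1 hy).symm

theorem interiorProduct_mem [CompleteSpace E] {k : ℕ}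
    (v : Cₛ^∞⟮I; E, (TangentSpace I : X → Type _)⟯) (η : Ω I X (k + 1)) :
    (fun x => interiorProduct I (v x) (η.1 x)) ∈ Ω I X k := fun x₀ =>
  (contDiffOn_curryLeft (η.2 x₀) (contDiffOn_chartRepField v x₀)).congr fun _ hy =>
    chartRep_interiorProduct v η.1 hy

theorem dFun_mem {f : X → ℝ} (hf : ContMDiff I 𝓘(ℝ, ℝ) ∞ f) : dFun I f ∈ Ω I X 1 := by
  intro x₀
  have h : ContDiffOn ℝ ∞ (fderiv ℝ (f ∘ (extChartAt I x₀).symm)) (extChartAt I x₀).target :=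
    (contDiffOn_comp_extChartAt_symm hf x₀).fderiv_of_isOpen (isOpen_extChartAt_target x₀) (by simp)
  have h' : ContDiff ℝ ∞ (fun L : E →L[ℝ] ℝ => ofSubsingletonLIE (𝕜 := ℝ) (E := E) (F := ℝ) (0 : Fin 1) L) :=
    (ofSubsingletonLIE (𝕜 := ℝ) (E := E) (F := ℝ) (0 : Fin 1)).contDiff
  exact (h'.comp_contDiffOn h).congr fun y hy => chartRep_dFun hy (hf.mdifferentiableAt (by simp))

/-- In the chart, `df` is the exterior derivative of `f` seen as a 0-form, so this is `d² = 0`. -/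
theorem extDerivAt_dFun {f : X → ℝ} (hf : ContMDiff I 𝓘(ℝ, ℝ) ∞ f) (x : X) :
    extDerivAt I (dFun I f) x = 0 := by
  have h : chartRep I (dFun I f) x =ᶠ[nhds (extChartAt I x x)]
      extDeriv (fun z => constOfIsEmpty ℝ E (Fin 0) (f ((extChartAt I x).symm z))) := by
    filter_upwards [extChartAt_target_mem_nhds (I := I) x] with y hy
    rw [chartRep_dFun hy (hf.mdifferentiableAt (by simp)), extDeriv_constOfIsEmpty]
    rfl
  have h' : ContDiffAt ℝ ∞ (fun z => constOfIsEmpty ℝ E (Fin 0) (f ((extChartAt I x).symm z)))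
      (extChartAt I x x) := by
    have h₁ : ContDiff ℝ ∞ (fun c : ℝ => constOfIsEmptyLIE ℝ E ℝ (Fin 0) c) :=
      (constOfIsEmptyLIE ℝ E ℝ (Fin 0)).contDiff
    exact h₁.contDiffAt.comp _
      ((contDiffOn_comp_extChartAt_symm hf x).contDiffAt (extChartAt_target_mem_nhds x))
  rw [extDerivAt, h.extDeriv_eq, extDeriv_extDeriv_apply h' minSmoothness_two_le]
  rfl

/-- Cartan's formula for the Lie derivative of a 1-form. -/
theorem lieDeriv_eq [CompleteSpace E] (v : Cₛ^∞⟮I; E, (TangentSpace I : X → Type _)⟯)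
    (η : Ω I X 1) (x : X) :
    lieDeriv I v η.1 x = interiorProduct I (v x) (extDerivAt I η.1 x) +
      dFun I (fun z => pairing I (v z) (η.1 z)) x := by
  have hx := mem_extChartAt_target (I := I) x
  have hev : (fun z => chartRep I η.1 x z ![chartRepField I v x z]) =ᶠ[nhds (extChartAt I x x)]
      (fun z => pairing I (v z) (η.1 z)) ∘ (extChartAt I x).symm := by
    filter_upwards [eventually_mem_target hx] with z hz
    exact chartRep_apply_chartRepField v η.1 hz
  have h : lieDerivModel (chartRepField I v x) (chartRep I η.1 x) (extChartAt I x x) =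
      chartRep I ((fun z => interiorProduct I (v z) (extDerivAt I η.1 z)) +
        dFun I (fun z => pairing I (v z) (η.1 z))) x (extChartAt I x x) := by
    rw [lieDerivModel_eq (chartRep_differentiableAt I η x)
      ((chartRepField_contDiffAt v hx).differentiableAt (by simp)), hev.fderiv_eq,
      ← chartRep_extDerivAt η hx, ← chartRep_interiorProduct _ _ hx,
      ← chartRep_dFun hx ((contMDiff_pairing v η).mdifferentiableAt (by simp))]
    rfl
  rw [lieDeriv, h]
  exact chartRep_compContinuousLinearMap _ (mem_extChartAt_source x)

/-- Cartan's formula holds on `X` and in the model space, and each operation on its right-hand side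
is already known to be computable in any chart. -/
theorem chartRep_lieDeriv [CompleteSpace E] (v : Cₛ^∞⟮I; E, (TangentSpace I : X → Type _)⟯)
    (η : Ω I X 1) {x₀ : X} {y : E} (hy : y ∈ (extChartAt I x₀).target) :
    chartRep I (lieDeriv I v η.1) x₀ y =
      lieDerivModel (chartRepField I v x₀) (chartRep I η.1 x₀) y := by
  have hev : (fun z => chartRep I η.1 x₀ z ![chartRepField I v x₀ z]) =ᶠ[nhds y]
      (fun z => pairing I (v z) (η.1 z)) ∘ (extChartAt I x₀).symm := by
    filter_upwards [eventually_mem_target hy] with z hz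
    exact chartRep_apply_chartRepField v η.1 hz
  rw [lieDerivModel_eq ((chartRep_contDiffAt η hy).differentiableAt (by simp))
      ((chartRepField_contDiffAt v hy).differentiableAt (by simp)), hev.fderiv_eq,
      ← chartRep_extDerivAt η hy, ← chartRep_interiorProduct _ _ hy,
      ← chartRep_dFun hy ((contMDiff_pairing v η).mdifferentiableAt (by simp)),
      funext (lieDeriv_eq v η)]
  rfl

theorem lieDeriv_mem [CompleteSpace E] (v : Cₛ^∞⟮I; E, (TangentSpace I : X → Type _)⟯)
    (η : Ω I X 1) : lieDeriv I v η.1 ∈ Ω I X 1 := by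
  intro x₀
  have h := ((interiorProduct_mem v ⟨_, extDerivAt_mem η⟩ x₀).add
    (dFun_mem (contMDiff_pairing v η) x₀))
  rw [funext (lieDeriv_eq v η)]
  exact h

end Charts

/-! ### Linearity of the differential and of the pairing. -/

section Pointwise

variable {E : Type*} [NormedAddCommGroup E] [NormedSpace ℝ E]
  {H : Type*} [TopologicalSpace H] {I : ModelWithCorners ℝ E H}
  {X : Type*} [TopologicalSpace X] [ChartedSpace H X]

theorem dFun_add {f g : X → ℝ} (hf : ContMDiff I 𝓘(ℝ, ℝ) ∞ f) (hg : ContMDiff I 𝓘(ℝ, ℝ) ∞ g)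
    (x : X) : dFun I (f + g) x = dFun I f x + dFun I g x := by
  rw [dFun, mfderiv_add (hf.mdifferentiableAt (by simp)) (hg.mdifferentiableAt (by simp))]
  rfl

theorem dFun_smul (c : ℝ) {f : X → ℝ} (hf : ContMDiff I 𝓘(ℝ, ℝ) ∞ f) (x : X) :
    dFun I (c • f) x = c • dFun I f x := by
  rw [dFun, const_smul_mfderiv (hf.mdifferentiableAt (by simp))]
  rfl

theorem pairing_add_left {x : X} (v w : TangentSpace I x) (α : TangentSpace I x [⋀^Fin 1]→L[ℝ] ℝ) :
    pairing I (v + w) α = pairing I v α + pairing I w α :=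
  α.toAlternatingMap.map_vecCons_add ![] v w

theorem pairing_smul_left {x : X} (c : ℝ) (v : TangentSpace I x)
    (α : TangentSpace I x [⋀^Fin 1]→L[ℝ] ℝ) : pairing I (c • v) α = c * pairing I v α :=
  α.toAlternatingMap.map_vecCons_smul ![] c v

end Pointwise

/-! ### Cartan calculus for smooth fields, functions and 1-forms. -/

section Calculus

variable {E : Type*} [NormedAddCommGroup E] [NormedSpace ℝ E]
  {H : Type*} [TopologicalSpace H] {I : ModelWithCorners ℝ E H} [I.Boundaryless]
  {X : Type*} [TopologicalSpace X] [ChartedSpace H X] [IsManifold I ∞ X]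

/-- The differential of a smooth function, as a smooth 1-form. -/
noncomputable def dForm (f : C^∞⟮I, X; ℝ⟯) : Ω I X 1 := ⟨dFun I f, dFun_mem f.contMDiff⟩

theorem dForm_add (f g : C^∞⟮I, X; ℝ⟯) : dForm (f + g) = dForm f + dForm g :=
  Subtype.ext (funext (dFun_add f.contMDiff g.contMDiff))

theorem dForm_smul (c : ℝ) (f : C^∞⟮I, X; ℝ⟯) : dForm (c • f) = c • dForm f :=
  Subtype.ext (funext (dFun_smul c f.contMDiff))

variable [CompleteSpace E]

/-- The pairing of a smooth vector field with a smooth 1-form, as a smooth function. -/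
noncomputable def pairingMap (v : Cₛ^∞⟮I; E, (TangentSpace I : X → Type _)⟯) (η : Ω I X 1) : C^∞⟮I, X; ℝ⟯ :=
  ⟨fun x => pairing I (v x) (η.1 x), contMDiff_pairing v η⟩

/-- The Lie derivative of a smooth 1-form, as a smooth 1-form. -/
noncomputable def lieForm (v : Cₛ^∞⟮I; E, (TangentSpace I : X → Type _)⟯) (η : Ω I X 1) : Ω I X 1 :=
  ⟨lieDeriv I v η.1, lieDeriv_mem v η⟩

theorem pairingMap_add_left (v w : Cₛ^∞⟮I; E, (TangentSpace I : X → Type _)⟯) (η : Ω I X 1) :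
    pairingMap (v + w) η = pairingMap v η + pairingMap w η := by
  ext x
  exact pairing_add_left (v x) (w x) (η.1 x)

theorem pairingMap_smul_left (c : ℝ) (v : Cₛ^∞⟮I; E, (TangentSpace I : X → Type _)⟯)
    (η : Ω I X 1) : pairingMap (c • v) η = c • pairingMap v η := by
  ext x
  exact pairing_smul_left c (v x) (η.1 x)

theorem pairingMap_zero_left (η : Ω I X 1) :
    pairingMap (0 : Cₛ^∞⟮I; E, (TangentSpace I : X → Type _)⟯) η = 0 := by
  simpa using pairingMap_smul_left 0 (0 : Cₛ^∞⟮I; E, (TangentSpace I : X → Type _)⟯) η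

theorem pairingMap_add_right (v : Cₛ^∞⟮I; E, (TangentSpace I : X → Type _)⟯) (η θ : Ω I X 1) :
    pairingMap v (η + θ) = pairingMap v η + pairingMap v θ := rfl

theorem pairingMap_smul_right (c : ℝ) (v : Cₛ^∞⟮I; E, (TangentSpace I : X → Type _)⟯)
    (η : Ω I X 1) : pairingMap v (c • η) = c • pairingMap v η := rfl

theorem lieForm_apply (v : Cₛ^∞⟮I; E, (TangentSpace I : X → Type _)⟯) (η : Ω I X 1) (x : X) :
    (lieForm v η).1 x =
      interiorProduct I (v x) (extDerivAt I η.1 x) + (dForm (pairingMap v η)).1 x :=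
  lieDeriv_eq v η x

theorem lieForm_add_left (v w : Cₛ^∞⟮I; E, (TangentSpace I : X → Type _)⟯) (η : Ω I X 1) :
    lieForm (v + w) η = lieForm v η + lieForm w η := by
  refine Subtype.ext (funext fun x => ?_)
  change _ = (lieForm v η).1 x + (lieForm w η).1 x
  rw [lieForm_apply, lieForm_apply, lieForm_apply, pairingMap_add_left, dForm_add,
    ContMDiffSection.coe_add, Pi.add_apply, interiorProduct_add]
  exact add_add_add_comm _ _ _ _

theorem lieForm_smul_left (c : ℝ) (v : Cₛ^∞⟮I; E, (TangentSpace I : X → Type _)⟯) (η : Ω I X 1) :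
    lieForm (c • v) η = c • lieForm v η := by
  refine Subtype.ext (funext fun x => ?_)
  change _ = c • (lieForm v η).1 x
  rw [lieForm_apply, lieForm_apply, pairingMap_smul_left, dForm_smul,
    ContMDiffSection.coe_smul, Pi.smul_apply, interiorProduct_smul, smul_add]
  rfl

theorem lieForm_zero_left (η : Ω I X 1) :
    lieForm (0 : Cₛ^∞⟮I; E, (TangentSpace I : X → Type _)⟯) η = 0 := by
  simpa using lieForm_smul_left 0 (0 : Cₛ^∞⟮I; E, (TangentSpace I : X → Type _)⟯) η

theorem lieForm_add_right (v : Cₛ^∞⟮I; E, (TangentSpace I : X → Type _)⟯) (η θ : Ω I X 1) :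
    lieForm v (η + θ) = lieForm v η + lieForm v θ := by
  refine Subtype.ext (funext fun x => ?_)
  change _ = (lieForm v η).1 x + (lieForm v θ).1 x
  rw [lieForm_apply, lieForm_apply, lieForm_apply, pairingMap_add_right, dForm_add, extDerivAt_add]
  exact add_add_add_comm (interiorProduct I (v x) (extDerivAt I η.1 x))
    (interiorProduct I (v x) (extDerivAt I θ.1 x)) ((dForm (pairingMap v η)).1 x)
    ((dForm (pairingMap v θ)).1 x)

theorem lieForm_smul_right (c : ℝ) (v : Cₛ^∞⟮I; E, (TangentSpace I : X → Type _)⟯) (η : Ω I X 1) :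
    lieForm v (c • η) = c • lieForm v η := by
  refine Subtype.ext (funext fun x => ?_)
  change _ = c • (lieForm v η).1 x
  rw [lieForm_apply, lieForm_apply, pairingMap_smul_right, dForm_smul, extDerivAt_smul, smul_add]
  rfl

/-- The Lie derivative commutes with the exterior derivative of functions. -/
theorem lieForm_dForm (v : Cₛ^∞⟮I; E, (TangentSpace I : X → Type _)⟯) (f : C^∞⟮I, X; ℝ⟯) :
    lieForm v (dForm f) = dForm (pairingMap v (dForm f)) := by
  refine Subtype.ext (funext fun x => ?_)
  have h : extDerivAt I (dForm f).1 x = 0 := extDerivAt_dFun f.contMDiff x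
  rw [lieForm_apply, h]
  exact zero_add _

/-- The commutator of Lie derivatives of 1-forms is the Lie derivative along the bracket. -/
theorem lieForm_lieForm (v w : Cₛ^∞⟮I; E, (TangentSpace I : X → Type _)⟯) (η : Ω I X 1) :
    lieForm v (lieForm w η) = lieForm (fieldBracket v w) η + lieForm w (lieForm v η) := by
  refine Subtype.ext (funext fun x => eq_of_chartRep_eq ?_)
  have hx := mem_extChartAt_target (I := I) x
  have hev (u : Cₛ^∞⟮I; E, (TangentSpace I : X → Type _)⟯) :
      chartRep I (lieForm u η).1 x =ᶠ[nhds (extChartAt I x x)]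
        lieDerivModel (chartRepField I u x) (chartRep I η.1 x) := by
    filter_upwards [eventually_mem_target hx] with z hz using chartRep_lieDeriv u η hz
  have hbr : chartRepField I (fieldBracket v w) x =ᶠ[nhds (extChartAt I x x)]
      lieBracket ℝ (chartRepField I v x) (chartRepField I w x) := by
    filter_upwards [eventually_mem_target hx] with z hz using chartRepField_mlieBracket v w hz
  have h₁ : chartRep I (lieForm v (lieForm w η)).1 x (extChartAt I x x) = _ :=
    chartRep_lieDeriv v (lieForm w η) hx
  have h₂ : chartRep I (lieForm (fieldBracket v w) η + lieForm w (lieForm v η)).1 x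
      (extChartAt I x x) = _ :=
    congrArg₂ (· + ·) (chartRep_lieDeriv (fieldBracket v w) η hx)
      (chartRep_lieDeriv w (lieForm v η) hx)
  have h2 : (2 : WithTop ℕ∞) ≤ ∞ := WithTop.coe_le_coe.2 le_top
  have key := lieDerivModel_lieBracket ((chartRep_contDiffAt η hx).of_le h2)
    ((chartRepField_contDiffAt v hx).of_le h2) ((chartRepField_contDiffAt w hx).of_le h2)
  rw [h₁, h₂]
  -- The outer Lie derivative sees only the value and first derivative of its arguments at the
  -- point, and local equality provides both.
  have hv := (hev v).fderiv_eq (𝕜 := ℝ)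
  have hv' := (hev v).eq_of_nhds
  have hw := (hev w).fderiv_eq (𝕜 := ℝ)
  have hw' := (hev w).eq_of_nhds
  have hb := hbr.fderiv_eq (𝕜 := ℝ)
  have hb' := hbr.eq_of_nhds
  simp only [lieDerivModel] at key ⊢ hv hw hv' hw'
  rw [hv, hw, hv', hw', hb, hb']
  exact key

/-- The Leibniz rule `v(η(w)) = η([v, w]) + (L_v η)(w)`. -/
theorem pairingMap_dForm_pairingMap (v w : Cₛ^∞⟮I; E, (TangentSpace I : X → Type _)⟯)
    (η : Ω I X 1) : pairingMap v (dForm (pairingMap w η)) =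
      pairingMap (fieldBracket v w) η + pairingMap w (lieForm v η) := by
  ext x
  have hx := mem_extChartAt_target (I := I) x
  have hsymm : (extChartAt I x).symm (extChartAt I x x) = x := extChartAt_to_inv x
  have hp (u : Cₛ^∞⟮I; E, (TangentSpace I : X → Type _)⟯) (θ : Ω I X 1) {y : E}
      (hy : y ∈ (extChartAt I x).target) : pairingMap u θ ((extChartAt I x).symm y) =
        chartRep I θ.1 x y ![chartRepField I u x y] :=
    (chartRep_apply_chartRepField u θ.1 hy).symm
  have hev : (pairingMap w η ∘ (extChartAt I x).symm) =ᶠ[nhds (extChartAt I x x)]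
      fun z => chartRep I η.1 x z ![chartRepField I w x z] := by
    filter_upwards [eventually_mem_target hx] with z hz using hp w η hz
  have hV := (chartRepField_contDiffAt v hx).differentiableAt (by simp)
  have hW := (chartRepField_contDiffAt w hx).differentiableAt (by simp)
  have h₁ : chartRep I (dForm (pairingMap w η)).1 x (extChartAt I x x) = _ :=
    chartRep_dFun hx ((pairingMap w η).contMDiff.mdifferentiableAt (by simp))
  have h₂ : chartRep I (lieForm v η).1 x (extChartAt I x x) = _ := chartRep_lieDeriv v η hx
  have h₃ : chartRepField I (fieldBracket v w) x (extChartAt I x x) = _ :=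
    chartRepField_mlieBracket v w hx
  have hsub (a b : E) : chartRep I η.1 x (extChartAt I x x) ![a - b] =
      chartRep I η.1 x (extChartAt I x x) ![a] - chartRep I η.1 x (extChartAt I x x) ![b] := by
    refine eq_sub_of_add_eq ?_
    rw [← sub_add_cancel a b, add_sub_cancel_right]
    exact ((chartRep I η.1 x (extChartAt I x x)).map_vecCons_add ![] (a - b) b).symm
  rw [ContMDiffMap.coe_add, Pi.add_apply, ← hsymm, hp _ _ hx, hp _ _ hx, hp _ _ hx, h₁, h₂, h₃,
    hev.fderiv_eq, ofSubsingleton_apply_apply, lieDerivModel_apply]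
  simp only [Matrix.cons_val_zero]
  -- Both sides become `(D_V η)(W) + η(D_V W)`; the term `η(D_W V)` of the Lie derivative cancels
  -- that of the bracket.
  rw [fderiv_apply_vecSingle (chartRep_differentiableAt I η x) hW, lieBracket, hsub]
  ring

end Calculus

/-! ### Hamiltonian forms, the hemi-bracket and the Lie 2-algebra. -/

section HamiltonianForms

variable {E : Type*} [NormedAddCommGroup E] [NormedSpace ℝ E]
  {H : Type*} [TopologicalSpace H] {I : ModelWithCorners ℝ E H} [I.Boundaryless]
  {X : Type*} [TopologicalSpace X] [ChartedSpace H X] [IsManifold I ∞ X] {ω₃ : Ω I X 3}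

theorem hamField_add (hω : IsTwoPlectic ω₃) (F G : Ham ω₃) :
    hamField (F + G) = hamField F + hamField G := by
  refine (hamField_unique hω (F + G) _ fun x => ?_).symm
  rw [ContMDiffSection.coe_add, Pi.add_apply, interiorProduct_add, neg_add, ← hamField_spec F x,
    ← hamField_spec G x]
  exact extDerivAt_add I ⟨F.1, F.2.1⟩ ⟨G.1, G.2.1⟩ x

theorem hamField_smul (hω : IsTwoPlectic ω₃) (c : ℝ) (F : Ham ω₃) :
    hamField (c • F) = c • hamField F := by
  refine (hamField_unique hω (c • F) _ fun x => ?_).symm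
  have h : extDerivAt I (c • F).1 x = c • extDerivAt I F.1 x :=
    extDerivAt_smul I c ⟨F.1, F.2.1⟩ x
  rw [ContMDiffSection.coe_smul, Pi.smul_apply, interiorProduct_smul, h, hamField_spec F x]
  ext u
  simp

theorem isHamiltonianField_dFun (f : C^∞⟮I, X; ℝ⟯) : IsHamiltonianField ω₃ (dFun I f) 0 := by
  intro x
  have h := interiorProduct_smul I (0 : ℝ) (0 : TangentSpace I x) (ω₃.1 x)
  rw [zero_smul, zero_smul] at h
  rw [ContMDiffSection.coe_zero, Pi.zero_apply, h, neg_zero]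
  exact extDerivAt_dFun f.contMDiff x

/-- The exterior derivative `d : C^∞(X) → Ham(X)`. -/
noncomputable def dHam (ω₃ : Ω I X 3) : C^∞⟮I, X; ℝ⟯ →ₗ[ℝ] Ham ω₃ where
  toFun f := ⟨dFun I f, dFun_mem f.contMDiff, 0, isHamiltonianField_dFun f⟩
  map_add' f g := by
    have h := congrArg Subtype.val (dForm_add f g)
    exact Subtype.ext h
  map_smul' c f := by
    have h := congrArg Subtype.val (dForm_smul c f)
    exact Subtype.ext h

/-- Since `d(df) = 0`, the zero field qualifies, and it is the only one. Hence every operation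
through `v_F` vanishes on exact `F`. -/
theorem hamField_dHam (hω : IsTwoPlectic ω₃) (f : C^∞⟮I, X; ℝ⟯) : hamField (dHam ω₃ f) = 0 :=
  (hamField_unique hω (dHam ω₃ f) 0 (isHamiltonianField_dFun f)).symm

/-- The inclusion `Ham(X) → Ω¹(X)`. -/
noncomputable def toForm : Ham ω₃ →ₗ[ℝ] Ω I X 1 where
  toFun F := ⟨F.1, F.2.1⟩
  map_add' _ _ := rfl
  map_smul' _ _ := rfl

theorem toForm_injective : Function.Injective (toForm : Ham ω₃ → Ω I X 1) :=
  fun F G h => Subtype.ext (show (toForm F).1 = (toForm G).1 by rw [h])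

/-- The contraction of `ω` with a Hamiltonian vector field is closed. -/
theorem extDeriv_curryLeft_hamField (F : Ham ω₃) (x : X) :
    extDeriv (fun z => (chartRep I ω₃.1 x z).curryLeft (chartRepField I (hamField F) x z))
      (extChartAt I x x) = 0 := by
  have hx := mem_extChartAt_target (I := I) x
  -- On the whole chart `ι_{v_F} ω = -dF`, so closedness is again `d² = 0`.
  have h : (fun z => (chartRep I ω₃.1 x z).curryLeft (chartRepField I (hamField F) x z))
      =ᶠ[nhds (extChartAt I x x)] (-1 : ℝ) • extDeriv (chartRep I F.1 x) := by
    filter_upwards [eventually_mem_target hx] with z hz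
    have h₁ : extDerivAt I F.1 =
        (-1 : ℝ) • fun x => interiorProduct I (hamField F x) (ω₃.1 x) := by
      funext x
      rw [hamField_spec F x]
      exact (neg_one_smul ℝ (interiorProduct I (hamField F x) (ω₃.1 x))).symm
    have h₂ := chartRep_extDerivAt (toForm F) hz
    change chartRep I (extDerivAt I F.1) x z = _ at h₂
    rw [h₁] at h₂
    change (-1 : ℝ) • chartRep I (fun x => interiorProduct I (hamField F x) (ω₃.1 x)) x z = _ at h₂
    rw [Pi.smul_apply]
    change _ = (-1 : ℝ) • extDeriv (chartRep I (toForm F).1 x) z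
    rw [← h₂, smul_smul, chartRep_interiorProduct _ _ hz]
    simp
  have hd : extDeriv (extDeriv (chartRep I F.1 x)) (extChartAt I x x) = 0 :=
    extDeriv_extDeriv_apply (chartRep_contDiffAt (toForm F) hx) minSmoothness_two_le
  rw [h.extDeriv_eq, extDeriv_smul, hd, smul_zero]

theorem toForm_dHam (f : C^∞⟮I, X; ℝ⟯) : (toForm (dHam ω₃ f)) = dForm f := rfl

variable [CompleteSpace E]

/-- The vector field `[v_F, v_G]` is a Hamiltonian vector field of `L_{v_F} G`. -/
theorem isHamiltonianField_lieForm (hω : IsTwoPlectic ω₃) (F G : Ham ω₃) :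
    IsHamiltonianField ω₃ (lieForm (hamField F) (toForm G)).1
      (fieldBracket (hamField F) (hamField G)) := by
  intro x
  have hx := mem_extChartAt_target (I := I) x
  -- `β = ι_{v_F} ι_{v_G} ω`. Cartan's formula and `dG = -ι_{v_G} ω` give `L_{v_F} G = -β` plus an
  -- exact form.
  let β : Ω I X 1 := ⟨_, interiorProduct_mem (hamField F) ⟨_, interiorProduct_mem (hamField G) ω₃⟩⟩
  have hβ : lieForm (hamField F) (toForm G) =
      (-1 : ℝ) • β + dForm (pairingMap (hamField F) (toForm G)) := by
    refine Subtype.ext (funext fun z => ?_)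
    rw [lieForm_apply]
    change interiorProduct I (hamField F z) (extDerivAt I G.1 z) + _ = (-1 : ℝ) • β.1 z + _
    rw [hamField_spec G z]
    congr 1
    exact (neg_one_smul ℝ (β.1 z)).symm
  have hdf : extDerivAt I (dForm (pairingMap (hamField F) (toForm G))).1 x = 0 :=
    extDerivAt_dFun (pairingMap (hamField F) (toForm G)).contMDiff x
  rw [hβ, extDerivAt_add, extDerivAt_smul, hdf, add_zero]
  have hα : extDeriv (chartRep I ω₃.1 x) (extChartAt I x x) = 0 := by
    rw [← chartRep_extDerivAt ω₃ hx, funext hω.closed]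
    rfl
  -- The inner contraction is with `v_G`, so the bracket appears as `[v_G, v_F]`; swapping it below
  -- absorbs the sign.
  have key := extDeriv_curryLeft_curryLeft (chartRep_differentiableAt I ω₃ x)
    ((chartRepField_contDiffAt (hamField G) hx).differentiableAt (by simp))
    ((chartRepField_contDiffAt (hamField F) hx).differentiableAt (by simp)) hα
    (extDeriv_curryLeft_hamField G x) (extDeriv_curryLeft_hamField F x)
  have hev : chartRep I β.1 x =ᶠ[nhds (extChartAt I x x)] fun z =>
      ((chartRep I ω₃.1 x z).curryLeft (chartRepField I (hamField G) x z)).curryLeft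
        (chartRepField I (hamField F) x z) := by
    filter_upwards [eventually_mem_target hx] with z hz
    rw [← chartRep_interiorProduct _ _ hz]
    exact chartRep_interiorProduct _ _ hz
  have hd : chartRep I (extDerivAt I β.1) x (extChartAt I x x) =
      chartRep I (fun z => interiorProduct I (fieldBracket (hamField F) (hamField G) z) (ω₃.1 z)) x
        (extChartAt I x x) := by
    rw [chartRep_extDerivAt β hx, hev.extDeriv_eq, key, chartRep_interiorProduct _ _ hx,
      lieBracket_swap, map_neg, neg_neg]
    exact congrArg _ (chartRepField_mlieBracket (hamField F) (hamField G) hx).symm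
  rw [eq_of_chartRep_eq hd]
  exact neg_one_smul ℝ (interiorProduct I (fieldBracket (hamField F) (hamField G) x) (ω₃.1 x))

/-- The hemi-bracket `{F, G} = L_{v_F} G` on Hamiltonian 1-forms. -/
noncomputable def hemiBracket (hω : IsTwoPlectic ω₃) : Ham ω₃ →ₗ[ℝ] Ham ω₃ →ₗ[ℝ] Ham ω₃ :=
  LinearMap.mk₂ ℝ
    (fun F G => ⟨(lieForm (hamField F) (toForm G)).1, (lieForm (hamField F) (toForm G)).2, _,
      isHamiltonianField_lieForm hω F G⟩)
    (fun F F' G => toForm_injective (by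
      change lieForm (hamField (F + F')) (toForm G) = _
      rw [hamField_add hω, lieForm_add_left]
      rfl))
    (fun c F G => toForm_injective (by
      change lieForm (hamField (c • F)) (toForm G) = _
      rw [hamField_smul hω, lieForm_smul_left]
      rfl))
    (fun F G G' => toForm_injective (lieForm_add_right (hamField F) (toForm G) (toForm G')))
    (fun c F G => toForm_injective (lieForm_smul_right c (hamField F) (toForm G)))

theorem toForm_hemiBracket (hω : IsTwoPlectic ω₃) (F G : Ham ω₃) :
    (toForm (hemiBracket hω F G)) = lieForm (hamField F) (toForm G) := rfl

theorem hamField_hemiBracket (hω : IsTwoPlectic ω₃) (F G : Ham ω₃) :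
    hamField (hemiBracket hω F G) = fieldBracket (hamField F) (hamField G) :=
  (hamField_unique hω (hemiBracket hω F G) _ (isHamiltonianField_lieForm hω F G)).symm

/-- The pairing `(F, η) ↦ ι_{v_F} η`. -/
noncomputable def hamPairing (hω : IsTwoPlectic ω₃) :
    Ham ω₃ →ₗ[ℝ] Ω I X 1 →ₗ[ℝ] C^∞⟮I, X; ℝ⟯ :=
  LinearMap.mk₂ ℝ (fun F η => pairingMap (hamField F) η)
    (fun F F' η => by rw [hamField_add hω, pairingMap_add_left])
    (fun c F η => by rw [hamField_smul hω, pairingMap_smul_left])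
    (fun F => pairingMap_add_right (hamField F))
    (fun c F => pairingMap_smul_right c (hamField F))

theorem hamPairing_apply (hω : IsTwoPlectic ω₃) (F : Ham ω₃) (η : Ω I X 1) :
    hamPairing hω F η = pairingMap (hamField F) η := rfl

/-- The differential of smooth functions as a linear map `C^∞(X) → Ω¹(X)`. -/
noncomputable def dFormLinear : C^∞⟮I, X; ℝ⟯ →ₗ[ℝ] Ω I X 1 where
  toFun := dForm
  map_add' := dForm_add
  map_smul' := dForm_smul

/-- The Leibniz rule for `L_{v_F}` with `[v_F, v_G]` read as the field of `{F, G}`. It supplies both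
`J_d_right` and `coherence_S_right`. -/
theorem hamPairing_hemiBracket_add (hω : IsTwoPlectic ω₃) (F G K : Ham ω₃) :
    hamPairing hω F (dForm (hamPairing hω G (toForm K))) =
      hamPairing hω (hemiBracket hω F G) (toForm K) +
        hamPairing hω G (toForm (hemiBracket hω F K)) := by
  rw [hamPairing_apply, hamPairing_apply, hamPairing_apply, hamPairing_apply,
    hamField_hemiBracket, toForm_hemiBracket]
  exact pairingMap_dForm_pairingMap _ _ _

theorem hemiBracket_dHam (hω : IsTwoPlectic ω₃) (F : Ham ω₃) (f : C^∞⟮I, X; ℝ⟯) :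
    hemiBracket hω F (dHam ω₃ f) = dHam ω₃ (hamPairing hω F (dForm f)) :=
  toForm_injective (show lieForm (hamField F) (dForm f) = dForm _ from lieForm_dForm (hamField F) f)

theorem hamPairing_dHam (hω : IsTwoPlectic ω₃) (f : C^∞⟮I, X; ℝ⟯) (η : Ω I X 1) :
    hamPairing hω (dHam ω₃ f) η = 0 := by
  rw [hamPairing_apply, hamField_dHam hω, pairingMap_zero_left]

theorem dHam_hemiBracket (hω : IsTwoPlectic ω₃) (f : C^∞⟮I, X; ℝ⟯) (F : Ham ω₃) :
    hemiBracket hω (dHam ω₃ f) F = 0 := by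
  apply toForm_injective
  rw [toForm_hemiBracket, hamField_dHam hω, lieForm_zero_left, _root_.map_zero]

/-- The symmetric part of the hemi-bracket is exact. -/
theorem hemiBracket_add_swap (hω : IsTwoPlectic ω₃) (F G : Ham ω₃) :
    hemiBracket hω F G + hemiBracket hω G F =
      dHam ω₃ (hamPairing hω F (toForm G) + hamPairing hω G (toForm F)) := by
  refine Subtype.ext (funext fun x => ?_)
  rw [map_add]
  change (lieForm (hamField F) (toForm G)).1 x + (lieForm (hamField G) (toForm F)).1 x =
    (dForm (pairingMap (hamField F) (toForm G))).1 x + (dForm (pairingMap (hamField G) (toForm F))).1 x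
  rw [lieForm_apply, lieForm_apply]
  -- The non-exact parts are `-ω(v_G, v_F, ·)` and `-ω(v_F, v_G, ·)`, which cancel because ω
  -- alternates.
  have h : interiorProduct I (hamField F x) (extDerivAt I G.1 x) +
      interiorProduct I (hamField G x) (extDerivAt I F.1 x) = 0 := by
    rw [hamField_spec F x, hamField_spec G x]
    ext u
    change -(ω₃.1 x (Matrix.vecCons (hamField G x) (Matrix.vecCons (hamField F x) u))) +
      -(ω₃.1 x (Matrix.vecCons (hamField F x) (Matrix.vecCons (hamField G x) u))) = 0
    have hs := (ω₃.1 x).map_swap (Matrix.vecCons (hamField F x) (Matrix.vecCons (hamField G x) u))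
      (i := 0) (j := 1) (by decide)
    have hs' : (ω₃.1 x) (Matrix.vecCons (hamField G x) (Matrix.vecCons (hamField F x) u)) =
        -(ω₃.1 x) (Matrix.vecCons (hamField F x) (Matrix.vecCons (hamField G x) u)) := by
      refine Eq.trans (congrArg (ω₃.1 x) ?_) hs
      funext i
      fin_cases i <;> rfl
    rw [hs', neg_neg, add_neg_cancel]
  refine (add_add_add_comm (interiorProduct I (hamField F x) (extDerivAt I G.1 x)) _
    (interiorProduct I (hamField G x) (extDerivAt I F.1 x)) _).trans ?_
  rw [h, zero_add]

theorem hemiBracket_jacobi (hω : IsTwoPlectic ω₃) (F G K : Ham ω₃) :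
    hemiBracket hω F (hemiBracket hω G K) =
      hemiBracket hω (hemiBracket hω F G) K + hemiBracket hω G (hemiBracket hω F K) := by
  apply toForm_injective
  rw [map_add]
  simp only [toForm_hemiBracket, hamField_hemiBracket]
  exact lieForm_lieForm _ _ _

/-- The hemistrict Lie 2-algebra `L(X, ω)_h` of a 2-plectic manifold. -/
noncomputable def hemistrictLie2Algebra (hω : IsTwoPlectic ω₃) :
    Lie2Algebra ℝ (Ham ω₃) C^∞⟮I, X; ℝ⟯ where
  d := dHam ω₃
  bracket := hemiBracket hω
  bracket₀₁ := (hamPairing hω).compl₂ dFormLinear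
  bracket₁₀ := 0
  S := -((hamPairing hω).compl₂ toForm + ((hamPairing hω).compl₂ toForm).flip)
  J := 0
  d_bracket₀₁ F f := (hemiBracket_dHam hω F f).symm
  d_bracket₁₀ f F := (_root_.map_zero _).trans (dHam_hemiBracket hω f F).symm
  bracket_d_d f g := by
    change hamPairing hω (dHam ω₃ f) (dForm g) - 0 = 0
    rw [hamPairing_dHam, sub_zero]
  d_S F G := by
    change _ + dHam ω₃ (-(hamPairing hω F (toForm G) + hamPairing hω G (toForm F))) = _
    rw [map_neg, ← hemiBracket_add_swap]
    abel
  S_d_right F f := by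
    change hamPairing hω F (dForm f) +
      -(hamPairing hω F (dForm f) + hamPairing hω (dHam ω₃ f) (toForm F)) = -0
    rw [hamPairing_dHam, add_zero, add_neg_cancel, neg_zero]
  S_d_left f F := by
    change 0 + -(hamPairing hω (dHam ω₃ f) (toForm F) + hamPairing hω F (dForm f)) =
      -hamPairing hω F (dForm f)
    rw [hamPairing_dHam, zero_add, zero_add]
  d_J F G K := by
    simpa using hemiBracket_jacobi hω F G K
  J_d_right F G f := by
    -- The Leibniz rule at `K = df`, together with `L_v d = d L_v`.
    have h := hamPairing_hemiBracket_add hω F G (dHam ω₃ f)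
    rw [hemiBracket_dHam, toForm_dHam, toForm_dHam] at h
    change hamPairing hω F (dForm (hamPairing hω G (dForm f))) + 0 = _
    rw [add_zero, h]
    rfl
  J_d_middle F f K := by simp
  J_d_left f G K := by simp
  J_antisymm_left F G K := by simp
  J_antisymm_right F G K := by simp
  coherence_J F G K L := by simp
  coherence_S_left F G K := by simp
  coherence_S_right F G K := by
    -- `S_{G,K}` has two summands; the Leibniz rule on each gives the four summands on the right.
    have h₁ := hamPairing_hemiBracket_add hω F G K
    have h₂ := hamPairing_hemiBracket_add hω F K G
    change hamPairing hω F
        (dFormLinear (-(hamPairing hω G (toForm K) + hamPairing hω K (toForm G)))) + -0 =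
      0 + (-(hamPairing hω (hemiBracket hω F G) (toForm K) +
          hamPairing hω K (toForm (hemiBracket hω F G))) +
        -(hamPairing hω G (toForm (hemiBracket hω F K)) +
          hamPairing hω (hemiBracket hω F K) (toForm G)))
    rw [map_neg, map_neg, map_add, map_add]
    change -(hamPairing hω F (dForm _) + hamPairing hω F (dForm _)) + -0 = _
    rw [h₁, h₂]
    abel
  coherence_S_symm F G K := by
    change -(hamPairing hω F (toForm (hemiBracket hω G K)) + hamPairing hω (hemiBracket hω G K) _) +
      -(-(hamPairing hω (hemiBracket hω G K) (toForm F) + hamPairing hω F _)) = 0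
    rw [neg_neg, add_comm (hamPairing hω (hemiBracket hω G K) (toForm F))]
    exact neg_add_cancel _

end HamiltonianForms

end TwoPlectic

theorem theorem4p3 {E : Type*} [NormedAddCommGroup E] [NormedSpace ℝ E] [FiniteDimensional ℝ E]
    {H : Type*} [TopologicalSpace H] (I : ModelWithCorners ℝ E H) [I.Boundaryless]
    {X : Type*} [TopologicalSpace X] [T2Space X] [SecondCountableTopology X]
    [ChartedSpace H X] [IsManifold I ∞ X]
    (ω₃ : TwoPlectic.Ω I X 3) (hω : TwoPlectic.IsTwoPlectic ω₃) :
    ∃ L : Lie2Algebra ℝ (TwoPlectic.Ham ω₃) C^∞⟮I, X; ℝ⟯,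
      (∀ (f : C^∞⟮I, X; ℝ⟯) (x : X), (L.d f).1 x = TwoPlectic.dFun I f x) ∧
      (∀ (F G : TwoPlectic.Ham ω₃) (x : X),
        (L.bracket F G).1 x = TwoPlectic.lieDeriv I (TwoPlectic.hamField F) G.1 x) ∧
      (∀ (F : TwoPlectic.Ham ω₃) (f : C^∞⟮I, X; ℝ⟯) (x : X),
        L.bracket₀₁ F f x = TwoPlectic.lieDerivFun I (TwoPlectic.hamField F) f x) ∧
      (∀ (f : C^∞⟮I, X; ℝ⟯) (F : TwoPlectic.Ham ω₃), L.bracket₁₀ f F = 0) ∧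
      (∀ (F G : TwoPlectic.Ham ω₃) (x : X),
        L.S F G x = -(TwoPlectic.pairing I (TwoPlectic.hamField F x) (G.1 x) +
          TwoPlectic.pairing I (TwoPlectic.hamField G x) (F.1 x))) ∧
      L.IsHemistrict := by
  -- Finite dimension enters through completeness of the model space, used for pullbacks and
  -- brackets of vector fields.
  have : CompleteSpace E := FiniteDimensional.complete ℝ E
  exact ⟨TwoPlectic.hemistrictLie2Algebra hω, fun _ _ => rfl, fun _ _ _ => rfl, fun _ _ _ => rfl,
    fun _ _ => rfl, fun _ _ _ => rfl, fun _ _ _ => rfl⟩
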